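/- Let $\Omega$ be the universal theory, i.e. the class of all sets with its membership relation $\in$ (well-founded, extensional, and with every small collection of sets being a set). Let $\Lambda\subseteq\Omega$ be a ZFC set theory: a transitive class such that $(\Lambda,\in)$ satisfies the first-order ZFC axioms (Separation and Replacement being required for first-order formulas with parameters in $\Lambda$). Elements of $\Lambda$ are called $\Lambda$-sets, and a function that is (as a set of pairs) an element of $\Lambda$ is called a $\Lambda$-function. *Coherent Limit axiom for $\Lambda$.* Suppose $A$ is a $\Lambda$-set, $\le$ is a well-order of $A$ that belongs to $\Lambda$, and for each $a\in A$ a $\Lambda$-function $f_a\colon\{c\in A: c\le a\}\to\{0,1\}$ is given, such that for all $b\le a$ in $A$ the restriction of $f_a$ to $\{c\in A:c\le b\}$ is $f_b$. (The family $(f_a)_{a\in A}$ is not required to belong to $\Lambda$.) Then the diagonal $F(a):=f_a(a)$ is a $\Lambda$-function $A\to\{0,1\}$. For a cardinal $k$, the truncation $\Omega_k$ is the class of sets hereditarily of cardinality less than $k$, i.e. of sets whose transitive closure has cardinality less than $k$. **Proposition.** Let $\Lambda\subseteq\Omega$ be a ZFC set theory. 1. $\Lambda=\Omega$ or $\Lambda=\Omega_k$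 for some strong limit cardinal $k$, if and only if $\Lambda$ satisfies the Coherent Limit axiom. 2. $\Lambda=\Omega$ or $\Lambda=\Omega_k$ for some regular strong limit cardinal $k$, if and only if $\Lambda$ satisfies the Coherent Limit axiom and Replacement holds in $\Lambda$ in the strong form: for every $\Lambda$-set $A$ and every function $f\colon A\to\Lambda$ whatsoever (not necessarily definable in $\Lambda$), there is a $\Lambda$-set $B$ with $f(a)\in B$ for all $a\in A$. In particular, among the ZFC set theories $\Lambda\subseteq\Omega$ that satisfy strong Replacement, the Coherent Limit axiom holds exactly in $\Omega$ and its truncations at regular strong limit cardinals. -/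

import Mathlib

universe u v

namespace RelaxedSet

/-! ### The first-order ZFC axioms for a binary relation -/

/-- The only symbol of the language of set theory: a binary relation symbol. -/
inductive MemSymbol : ℕ → Type
  | mem : MemSymbol 2

/-- The first-order language of set theory. -/
def memLanguage : FirstOrder.Language where
  Functions := fun _ => Empty
  Relations := MemSymbol

/-- A binary relation `E` on `M` ("`E x y`" is read "`x` is a member of `y`") as a structure
for the language of set theory. -/
@[reducible] def memStructure {M : Type v} (E : M → M → Prop) : memLanguage.Structure M where
  funMap := fun f _ => f.elim
  RelMap := fun R =>
    match R with
    | MemSymbol.mem => fun x => E (x 0) (x 1)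

/-- The subclass `s` is given by a first-order formula in `E`, with parameters from `M`. -/
def FODefinable₁ {M : Type v} (E : M → M → Prop) (s : Set M) : Prop :=
  letI := memStructure E
  (Set.univ : Set M).Definable₁ memLanguage s

/-- The binary class relation `s` is given by a first-order formula in `E`, with parameters
from `M`. -/
def FODefinable₂ {M : Type v} (E : M → M → Prop) (s : Set (M × M)) : Prop :=
  letI := memStructure E
  (Set.univ : Set M).Definable₂ memLanguage s

/-- The pairing `(M, E)` satisfies the axioms of (first-order) ZFC. -/
structure SatisfiesZFC {M : Type v} (E : M → M → Prop) : Prop where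
  extensionality : ∀ a b, (∀ x, E x a ↔ E x b) → a = b
  regularity : ∀ a, (∃ x, E x a) → ∃ x, E x a ∧ ∀ y, E y a → ¬ E y x
  pairing : ∀ a b, ∃ c, ∀ x, E x c ↔ x = a ∨ x = b
  union : ∀ a, ∃ c, ∀ x, E x c ↔ ∃ b, E x b ∧ E b a
  powerset : ∀ a, ∃ c, ∀ b, E b c ↔ ∀ x, E x b → E x a
  /-- There is a set that has an empty member and contains `x ∪ {x}` whenever it contains `x`. -/
  infinity : ∃ a, (∃ e, E e a ∧ ∀ x, ¬ E x e) ∧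
    ∀ x, E x a → ∃ s, E s a ∧ ∀ y, E y s ↔ E y x ∨ y = x
  /-- A set of nonempty pairwise disjoint sets has a transversal. -/
  choice : ∀ a, (∀ x, E x a → ∃ z, E z x) →
    (∀ x y, E x a → E y a → (∃ z, E z x ∧ E z y) → x = y) →
    ∃ c, ∀ x, E x a → ∃! z, E z x ∧ E z c
  separation : ∀ s : Set M, FODefinable₁ E s → ∀ a, ∃ c, ∀ x, E x c ↔ E x a ∧ x ∈ s
  replacement : ∀ R : Set (M × M), FODefinable₂ E R → ∀ a,
    (∀ x, E x a → ∀ y z, (x, y) ∈ R → (x, z) ∈ R → y = z) →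
    ∃ c, ∀ y, E y c ↔ ∃ x, E x a ∧ (x, y) ∈ R

/-! ### Set theories inside the universal one

The universal theory is `ZFSet`: its membership is well-founded and extensional, and *every*
small collection of its elements is the extension of an element. -/

/-- `Λ` is a ZFC set theory inside the universal theory: a transitive class (the sets of `Λ` have
in `Λ` the same members as in the universal theory) whose membership satisfies ZFC. -/
structure IsZFCTheory (Λ : Set ZFSet.{u}) : Prop where
  transitive : ∀ x ∈ Λ, ∀ y ∈ x, y ∈ Λ
  zfc : SatisfiesZFC (fun x y : Λ => (x : ZFSet.{u}) ∈ (y : ZFSet.{u}))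

/-- The truncation of the universal theory at the cardinal `k`: the sets hereditarily of
cardinality less than `k`, that is, those whose transitive closure has cardinality less
than `k`. -/
def truncation (k : Cardinal.{u}) : Set ZFSet.{u} :=
  {x | ∃ t : ZFSet.{u}, t.IsTransitive ∧ x ⊆ t ∧ t.card < k}

/-- Replacement in the strong form, not restricted to first-order definable functions: any
function whatsoever from a `Λ`-set to `Λ` is bounded, i.e. has its values in a `Λ`-set. -/
def StrongReplacement (Λ : Set ZFSet.{u}) : Prop :=
  ∀ A ∈ Λ, ∀ f : ZFSet.{u} → ZFSet.{u}, (∀ a ∈ A, f a ∈ Λ) → ∃ B ∈ Λ, ∀ a ∈ A, f a ∈ B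

/-! ### The Coherent Limit axiom -/

/-- The two-element set `{0, 1}`, with `0 = ∅` and `1 = {∅}`. -/
def two : ZFSet.{u} := {∅, {∅}}

/-- The set of pairs `r` is a well-order `≤` of the set `A`. -/
structure IsWellOrderOn (A r : ZFSet.{u}) : Prop where
  subset_prod : r ⊆ ZFSet.prod A A
  total : ∀ a ∈ A, ∀ b ∈ A, ZFSet.pair a b ∈ r ∨ ZFSet.pair b a ∈ r
  antisymm : ∀ a ∈ A, ∀ b ∈ A, ZFSet.pair a b ∈ r → ZFSet.pair b a ∈ r → a = b
  trans : ∀ a ∈ A, ∀ b ∈ A, ∀ c ∈ A,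
    ZFSet.pair a b ∈ r → ZFSet.pair b c ∈ r → ZFSet.pair a c ∈ r
  exists_least : ∀ B : ZFSet.{u}, B ⊆ A → B ≠ ∅ → ∃ m ∈ B, ∀ b ∈ B, ZFSet.pair m b ∈ r

/-- The closed initial segment `{c ∈ A | c ≤ a}`. -/
def initialSegment (A r a : ZFSet.{u}) : ZFSet.{u} :=
  ZFSet.sep (fun c => ZFSet.pair c a ∈ r) A

/-- The restriction of the function (set of pairs) `f` to `B`. -/
def restrict (f B : ZFSet.{u}) : ZFSet.{u} :=
  ZFSet.sep (fun p => ∃ c ∈ B, ∃ v, p = ZFSet.pair c v) f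

/-- The diagonal `F(a) = f_a(a)` of a family of functions `f_a` indexed by `a ∈ A`, each with
values in `{0, 1}`. -/
def diagonal (A : ZFSet.{u}) (f : ZFSet.{u} → ZFSet.{u}) : ZFSet.{u} :=
  ZFSet.sep (fun p => ∃ a ∈ A, ∃ v, p = ZFSet.pair a v ∧ ZFSet.pair a v ∈ f a) (ZFSet.prod A two)

/-- The Coherent Limit axiom for `Λ`. The individual functions `f a` are `Λ`-sets; the family
`a ↦ f a` is arbitrary, and need not belong to `Λ`. -/
def CoherentLimit (Λ : Set ZFSet.{u}) : Prop :=
  ∀ A ∈ Λ, ∀ r ∈ Λ, IsWellOrderOn A r →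
    ∀ f : ZFSet.{u} → ZFSet.{u},
      (∀ a ∈ A, f a ∈ Λ ∧ ZFSet.IsFunc (initialSegment A r a) two (f a)) →
      (∀ a ∈ A, ∀ b ∈ A, ZFSet.pair b a ∈ r → restrict (f a) (initialSegment A r b) = f b) →
      diagonal A f ∈ Λ ∧ ZFSet.IsFunc A two (diagonal A f)

end RelaxedSet

/-! The Coherent Limit axiom amounts to closure under arbitrary subsets, and this closure determines
`Λ` up to the cardinalities that occur in it.

Let `T` be an ordinal in `Λ` and `B ⊆ T`. By induction `B ∩ a ∈ Λ` for each `a ∈ T`, so the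
characteristic functions of `B` on the segments `a ∪ {a}` are `Λ`-functions. They cohere, and their
diagonal is the characteristic function of `B` on `T`; hence `B ∈ Λ`
(`CoherentLimit.subset_ordinal_mem_class`). The well-ordering theorem, carried out inside `Λ`,
transfers this from ordinals to all `Λ`-sets (`CoherentLimit.subset_mem_class`).

If a transitive set `t` injects into some `A ∈ Λ`, the copy of its membership relation is a subset
of `A × A`, so it lies in `Λ`, where Mostowski collapse recovers `t`
(`CoherentLimit.transitive_mem_class`). Thus if the cardinalities of `Λ`-sets are unbounded, `Λ` is
everything; otherwise `Λ` is the truncation at their least strict upper bound `k`, a strong limit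
because power sets in `Λ` are true power sets. Conversely, a diagonal is a subset of `A × 2`, and
truncations are closed under subsets.

Strong Replacement corresponds to regularity of `k`: a union of fewer than `k` sets of size less
than `k` stays small, while a short cofinal family in `k`, once bounded by a set of the truncation,
would yield a set there of size at least `k`. -/

namespace RelaxedSet

open FirstOrder Set ZFSet

/-! ### First-order definability over a class of sets -/

section Definability

variable {Λ : Set ZFSet.{u}}

/-- A predicate of `n`-tuples in `Λ` that is first-order definable with parameters in `Λ`. -/
def FODef {n : ℕ} (P : (Fin n → Λ) → Prop) : Prop :=
  letI := memStructure (fun x y : Λ => (x : ZFSet.{u}) ∈ (y : ZFSet.{u}))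
  (Set.univ : Set Λ).Definable memLanguage {v | P v}

/-- A definable function of `n`-tuples in `Λ` with values in `Λ`. -/
structure FOTerm {n : ℕ} (x : (Fin n → Λ) → ZFSet.{u}) : Prop where
  mem_class : ∀ v, x v ∈ Λ
  graph : FODef (fun w : Fin (n + 1) → Λ => (w 0 : ZFSet.{u}) = x (fun i => w i.succ))

namespace FODef

variable {n : ℕ} {P Q : (Fin n → Λ) → Prop}

theorem congr (h : FODef P) (hPQ : ∀ v, P v ↔ Q v) : FODef Q := by
  have : P = Q := funext fun v => propext (hPQ v)
  exact this ▸ h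

theorem and (hP : FODef P) (hQ : FODef Q) : FODef (fun v => P v ∧ Q v) := by
  let := memStructure (fun x y : Λ => (x : ZFSet.{u}) ∈ (y : ZFSet.{u}))
  exact Definable.inter hP hQ

theorem or (hP : FODef P) (hQ : FODef Q) : FODef (fun v => P v ∨ Q v) := by
  let := memStructure (fun x y : Λ => (x : ZFSet.{u}) ∈ (y : ZFSet.{u}))
  exact Definable.union hP hQ

theorem not (hP : FODef P) : FODef (fun v => ¬ P v) := by
  let := memStructure (fun x y : Λ => (x : ZFSet.{u}) ∈ (y : ZFSet.{u}))
  exact Definable.compl hP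

theorem imp (hP : FODef P) (hQ : FODef Q) : FODef (fun v => P v → Q v) :=
  (hP.not.or hQ).congr fun _ => imp_iff_not_or.symm

theorem iff (hP : FODef P) (hQ : FODef Q) : FODef (fun v => P v ↔ Q v) :=
  ((hP.imp hQ).and (hQ.imp hP)).congr fun _ => iff_iff_implies_and_implies.symm

theorem comp {m : ℕ} (hP : FODef P) (f : Fin n → Fin m) :
    FODef (fun v : Fin m → Λ => P (fun i => v (f i))) := by
  let := memStructure (fun x y : Λ => (x : ZFSet.{u}) ∈ (y : ZFSet.{u}))
  exact Definable.preimage_comp f hP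

theorem var_eq_var (i j : Fin n) :
    FODef (fun v : Fin n → Λ => (v i : ZFSet.{u}) = v j) := by
  let := memStructure (fun x y : Λ => (x : ZFSet.{u}) ∈ (y : ZFSet.{u}))
  have h : FODef (fun v : Fin n → Λ => v i = v j) :=
    Definable.preimage_comp ![i, j] (Definable.diagonal memLanguage (univ : Set Λ))
  exact h.congr fun v => Subtype.ext_iff

theorem var_eq_const (i : Fin n) (c : Λ) :
    FODef (fun v : Fin n → Λ => (v i : ZFSet.{u}) = c) := by
  let := memStructure (fun x y : Λ => (x : ZFSet.{u}) ∈ (y : ZFSet.{u}))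
  have h : FODef (fun v : Fin n → Λ => v i = c) :=
    Definable.preimage_comp (fun _ : Fin 1 => i)
      (Definable.singleton_of_mem memLanguage (mem_univ c))
  exact h.congr fun v => Subtype.ext_iff

theorem var_mem_var (i j : Fin n) :
    FODef (fun v : Fin n → Λ => (v i : ZFSet.{u}) ∈ (v j : ZFSet.{u})) := by
  let := memStructure (fun x y : Λ => (x : ZFSet.{u}) ∈ (y : ZFSet.{u}))
  refine Definable.mono (Set.empty_definable_iff.2
    ⟨Language.Relations.formula₂ (L := memLanguage) MemSymbol.mem
      (Language.Term.var i) (Language.Term.var j), ?_⟩) (empty_subset _)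
  ext v
  simp
  rfl

/-- Quantification is projection along coordinate 0. The bound variable always takes index 0 and the
free ones are shifted by `Fin.succ`, as with de Bruijn indices. -/
theorem ex {P : (Fin n → Λ) → ZFSet.{u} → Prop}
    (h : FODef (fun w : Fin (n + 1) → Λ => P (fun i => w i.succ) (w 0))) :
    FODef (fun v => ∃ x ∈ Λ, P v x) := by
  let := memStructure (fun x y : Λ => (x : ZFSet.{u}) ∈ (y : ZFSet.{u}))
  refine FODef.congr (P := fun v => v ∈ (fun g : Fin (n + 1) → Λ => g ∘ Fin.succ) ''
    {w : Fin (n + 1) → Λ | P (fun i => w i.succ) (w 0)}) (Definable.image_comp h Fin.succ)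
    fun v => ⟨?_, ?_⟩
  · rintro ⟨w, hw, rfl⟩
    exact ⟨w 0, (w 0).2, hw⟩
  · rintro ⟨x, hx, h⟩
    exact ⟨Fin.cons ⟨x, hx⟩ v, h, rfl⟩

theorem all {P : (Fin n → Λ) → ZFSet.{u} → Prop}
    (h : FODef (fun w : Fin (n + 1) → Λ => P (fun i => w i.succ) (w 0))) :
    FODef (fun v => ∀ x ∈ Λ, P v x) :=
  (FODef.ex (P := fun v x => ¬ P v x) h.not).not.congr fun v => by push Not; rfl

end FODef

namespace FOTerm

variable {n : ℕ} {x y : (Fin n → Λ) → ZFSet.{u}}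

theorem var (i : Fin n) : FOTerm (fun v : Fin n → Λ => (v i : ZFSet.{u})) :=
  ⟨fun v => (v i).2, FODef.var_eq_var _ _⟩

theorem const {c : ZFSet.{u}} (hc : c ∈ Λ) : FOTerm (fun _ : Fin n → Λ => c) :=
  ⟨fun _ => hc, FODef.var_eq_const _ ⟨c, hc⟩⟩

theorem comp {m : ℕ} (hx : FOTerm x) (f : Fin n → Fin m) :
    FOTerm (fun v : Fin m → Λ => x (fun i => v (f i))) :=
  ⟨fun _ => hx.mem_class _, (hx.graph.comp (Fin.cons 0 fun i => (f i).succ)).congr fun v => by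
    simp⟩

end FOTerm

namespace FODef

variable {n : ℕ} {x y : (Fin n → Λ) → ZFSet.{u}}

/-- `P v (x v)` is rewritten as `∃ a, a = x v ∧ P v a`, which involves only the graph of `x`. -/
theorem subst {P : (Fin n → Λ) → ZFSet.{u} → Prop}
    (h : FODef (fun w : Fin (n + 1) → Λ => P (fun i => w i.succ) (w 0))) (hx : FOTerm x) :
    FODef (fun v => P v (x v)) :=
  (FODef.ex (P := fun v a => a = x v ∧ P v a) (hx.graph.and h)).congr fun v =>
    ⟨by rintro ⟨_, _, rfl, h⟩; exact h, fun h => ⟨_, hx.mem_class v, rfl, h⟩⟩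

theorem eq (hx : FOTerm x) (hy : FOTerm y) : FODef (fun v => x v = y v) :=
  subst (P := fun v a => a = y v) hy.graph hx

theorem mem (hx : FOTerm x) (hy : FOTerm y) : FODef (fun v => x v ∈ y v) :=
  subst (P := fun v a => a ∈ y v)
    (subst (P := fun (w : Fin (n + 1) → Λ) b => (w 0 : ZFSet.{u}) ∈ b)
      (var_mem_var _ _) (hy.comp Fin.succ)) hx

end FODef

end Definability

/-! ### Closure properties and definability in a ZFC set theory -/

section Closure

variable {Λ : Set ZFSet.{u}} {n : ℕ} {x y : (Fin n → Λ) → ZFSet.{u}}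

namespace FODef

theorem exMem {P : (Fin n → Λ) → ZFSet.{u} → Prop} (hΛ : IsZFCTheory Λ) (hx : FOTerm x)
    (h : FODef (fun w : Fin (n + 1) → Λ => P (fun i => w i.succ) (w 0))) :
    FODef (fun v => ∃ a ∈ x v, P v a) :=
  (FODef.ex (P := fun v a => a ∈ x v ∧ P v a)
    ((mem (FOTerm.var 0) (hx.comp Fin.succ)).and h)).congr fun v =>
    ⟨fun ⟨a, _, h⟩ => ⟨a, h⟩,
      fun ⟨a, h⟩ => ⟨a, hΛ.transitive _ (hx.mem_class v) _ h.1, h⟩⟩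

theorem allMem {P : (Fin n → Λ) → ZFSet.{u} → Prop} (hΛ : IsZFCTheory Λ) (hx : FOTerm x)
    (h : FODef (fun w : Fin (n + 1) → Λ => P (fun i => w i.succ) (w 0))) :
    FODef (fun v => ∀ a ∈ x v, P v a) :=
  (FODef.exMem (P := fun v a => ¬ P v a) hΛ hx h.not).not.congr fun v => by push Not; rfl

theorem subset (hΛ : IsZFCTheory Λ) (hx : FOTerm x) (hy : FOTerm y) :
    FODef (fun v => x v ⊆ y v) :=
  (FODef.allMem (P := fun v a => a ∈ y v) hΛ hx
    (mem (FOTerm.var 0) (hy.comp Fin.succ))).congr fun _ => ZFSet.subset_def.symm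

theorem isTransitive (hΛ : IsZFCTheory Λ) (hx : FOTerm x) :
    FODef (fun v => (x v).IsTransitive) :=
  FODef.allMem (P := fun v a => a ⊆ x v) hΛ hx (subset hΛ (FOTerm.var 0) (hx.comp Fin.succ))

theorem isOrdinal (hΛ : IsZFCTheory Λ) (hx : FOTerm x) :
    FODef (fun v => (x v).IsOrdinal) :=
  ((isTransitive hΛ hx).and (FODef.allMem (P := fun _ a => a.IsTransitive) hΛ hx
    (isTransitive hΛ (FOTerm.var 0)))).congr fun _ =>
      isOrdinal_iff_forall_mem_isTransitive.symm

end FODef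

namespace IsZFCTheory

variable {a b : ZFSet.{u}}

/-- Passes from the axioms, which quantify over the subtype `Λ`, to true membership: by transitivity
a `Λ`-set has no members outside `Λ`. -/
theorem exists_mem_iff (hΛ : IsZFCTheory Λ) {P : ZFSet.{u} → Prop}
    (h : ∃ c : Λ, ∀ x : Λ, (x : ZFSet.{u}) ∈ (c : ZFSet.{u}) ↔ P x) :
    ∃ c ∈ Λ, ∀ x, x ∈ c ↔ x ∈ Λ ∧ P x := by
  obtain ⟨⟨c, hc⟩, h⟩ := h
  refine ⟨c, hc, fun x => ⟨fun hx => ?_, fun ⟨hx, hP⟩ => (h ⟨x, hx⟩).2 hP⟩⟩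
  have hx' := hΛ.transitive c hc x hx
  exact ⟨hx', (h ⟨x, hx'⟩).1 hx⟩

theorem pair_mem_class (hΛ : IsZFCTheory Λ) (ha : a ∈ Λ) (hb : b ∈ Λ) :
    ({a, b} : ZFSet.{u}) ∈ Λ := by
  obtain ⟨c, hc⟩ := hΛ.zfc.pairing ⟨a, ha⟩ ⟨b, hb⟩
  obtain ⟨c, hc, h⟩ := hΛ.exists_mem_iff (P := fun x => x = a ∨ x = b)
    ⟨c, fun x => by simpa [Subtype.ext_iff] using hc x⟩
  convert hc
  ext x
  rw [h, ZFSet.mem_pair]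
  exact ⟨by rintro (rfl | rfl) <;> simp [*], And.right⟩

theorem singleton_mem_class (hΛ : IsZFCTheory Λ) (ha : a ∈ Λ) : ({a} : ZFSet.{u}) ∈ Λ := by
  simpa using hΛ.pair_mem_class ha ha

theorem opair_mem_class (hΛ : IsZFCTheory Λ) (ha : a ∈ Λ) (hb : b ∈ Λ) :
    ZFSet.pair a b ∈ Λ :=
  hΛ.pair_mem_class (hΛ.singleton_mem_class ha) (hΛ.pair_mem_class ha hb)

theorem mem_class_of_opair (hΛ : IsZFCTheory Λ) (h : ZFSet.pair a b ∈ Λ) : a ∈ Λ ∧ b ∈ Λ := by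
  have h1 : ({a, b} : ZFSet.{u}) ∈ Λ := hΛ.transitive _ h _ (by simp [ZFSet.pair])
  exact ⟨hΛ.transitive _ h1 _ (by simp), hΛ.transitive _ h1 _ (by simp)⟩

theorem sUnion_mem_class (hΛ : IsZFCTheory Λ) (ha : a ∈ Λ) : (⋃₀ a : ZFSet.{u}) ∈ Λ := by
  obtain ⟨c, hc⟩ := hΛ.zfc.union ⟨a, ha⟩
  obtain ⟨c, hc, h⟩ := hΛ.exists_mem_iff (P := fun x => ∃ b, x ∈ b ∧ b ∈ Λ ∧ b ∈ a)
    ⟨c, fun x => by simpa using hc x⟩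
  convert hc
  ext x
  rw [h, ZFSet.mem_sUnion]
  constructor
  · rintro ⟨z, hz, hx⟩
    have hz' := hΛ.transitive _ ha _ hz
    exact ⟨hΛ.transitive _ hz' _ hx, z, hx, hz', hz⟩
  · rintro ⟨_, z, hx, _, hz⟩
    exact ⟨z, hz, hx⟩

theorem union_mem_class (hΛ : IsZFCTheory Λ) (ha : a ∈ Λ) (hb : b ∈ Λ) : a ∪ b ∈ Λ := by
  rw [← ZFSet.sUnion_pair]
  exact hΛ.sUnion_mem_class (hΛ.pair_mem_class ha hb)

theorem insert_mem_class (hΛ : IsZFCTheory Λ) (ha : a ∈ Λ) (hb : b ∈ Λ) : insert a b ∈ Λ := by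
  rw [ZFSet.insert_eq]
  exact hΛ.union_mem_class (hΛ.singleton_mem_class ha) hb

theorem exists_powerset (hΛ : IsZFCTheory Λ) (ha : a ∈ Λ) :
    ∃ c ∈ Λ, ∀ x, x ∈ c ↔ x ∈ Λ ∧ x ⊆ a := by
  obtain ⟨c, hc⟩ := hΛ.zfc.powerset ⟨a, ha⟩
  refine hΛ.exists_mem_iff ⟨c, fun x => (hc x).trans ⟨fun h y hy => ?_, fun h y hy => h hy⟩⟩
  exact h ⟨y, hΛ.transitive _ x.2 _ hy⟩ hy

theorem sep_mem_class (hΛ : IsZFCTheory Λ) {P : ZFSet.{u} → Prop} (ha : a ∈ Λ)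
    (hP : FODef (fun v : Fin 1 → Λ => P (v 0))) : ZFSet.sep P a ∈ Λ := by
  obtain ⟨c, hc⟩ := hΛ.zfc.separation {x | P x} hP ⟨a, ha⟩
  obtain ⟨c, hc, h⟩ := hΛ.exists_mem_iff (P := fun x => x ∈ a ∧ P x) ⟨c, hc⟩
  convert hc
  ext x
  rw [h, ZFSet.mem_sep]
  exact ⟨fun h => ⟨hΛ.transitive _ ha _ h.1, h⟩, And.right⟩

theorem replacement (hΛ : IsZFCTheory Λ) {R : ZFSet.{u} → ZFSet.{u} → Prop} (ha : a ∈ Λ)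
    (hR : FODef (fun v : Fin 2 → Λ => R (v 0) (v 1)))
    (huniq : ∀ x ∈ a, ∀ y ∈ Λ, ∀ z ∈ Λ, R x y → R x z → y = z) :
    ∃ c ∈ Λ, ∀ y, y ∈ c ↔ y ∈ Λ ∧ ∃ x ∈ a, R x y := by
  obtain ⟨c, hc⟩ := hΛ.zfc.replacement {p | R p.1 p.2} hR ⟨a, ha⟩
    fun x hx y z hy hz => Subtype.ext (huniq x hx y y.2 z z.2 hy hz)
  refine hΛ.exists_mem_iff ⟨c, fun y => (hc y).trans ⟨?_, ?_⟩⟩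
  · rintro ⟨x, hx, h⟩
    exact ⟨x, hx, h⟩
  · rintro ⟨x, hx, h⟩
    exact ⟨⟨x, hΛ.transitive _ ha _ hx⟩, hx, h⟩

theorem empty_mem_class (hΛ : IsZFCTheory Λ) : (∅ : ZFSet.{u}) ∈ Λ := by
  obtain ⟨_, ⟨e, _, he⟩, _⟩ := hΛ.zfc.infinity
  convert e.2
  refine ((ZFSet.eq_empty _).2 fun y hy => ?_).symm
  exact he ⟨y, hΛ.transitive _ e.2 _ hy⟩ hy

end IsZFCTheory

namespace FOTerm

theorem unorderedPair (hΛ : IsZFCTheory Λ) (hx : FOTerm x) (hy : FOTerm y) :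
    FOTerm (fun v => ({x v, y v} : ZFSet.{u})) := by
  refine ⟨fun v => hΛ.pair_mem_class (hx.mem_class v) (hy.mem_class v), ?_⟩
  refine ((FODef.mem (hx.comp Fin.succ) (FOTerm.var 0)).and
    ((FODef.mem (hy.comp Fin.succ) (FOTerm.var 0)).and
    (FODef.allMem (P := fun (w : Fin (n + 1) → Λ) a =>
      a = x (fun i => w i.succ) ∨ a = y (fun i => w i.succ)) hΛ (FOTerm.var 0)
      ((FODef.eq (FOTerm.var 0) ((hx.comp Fin.succ).comp Fin.succ)).or
        (FODef.eq (FOTerm.var 0) ((hy.comp Fin.succ).comp Fin.succ)))))).congr fun v => ?_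
  constructor
  · rintro ⟨h1, h2, h3⟩
    ext a
    rw [ZFSet.mem_pair]
    exact ⟨h3 a, by rintro (rfl | rfl) <;> assumption⟩
  · rintro h
    simp [h]

theorem pair (hΛ : IsZFCTheory Λ) (hx : FOTerm x) (hy : FOTerm y) :
    FOTerm (fun v => ZFSet.pair (x v) (y v)) := by
  simpa [ZFSet.pair] using unorderedPair hΛ (unorderedPair hΛ hx hx) (unorderedPair hΛ hx hy)

end FOTerm

namespace IsZFCTheory

variable {a b : ZFSet.{u}}

theorem prod_mem_class (hΛ : IsZFCTheory Λ) (ha : a ∈ Λ) (hb : b ∈ Λ) : ZFSet.prod a b ∈ Λ := by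
  obtain ⟨P, hP, h1⟩ := hΛ.exists_powerset (hΛ.union_mem_class ha hb)
  obtain ⟨Q, hQ, h2⟩ := hΛ.exists_powerset hP
  convert hΛ.sep_mem_class (P := fun p => ∃ x ∈ a, ∃ y ∈ b, p = ZFSet.pair x y) hQ ?_
  · ext p
    rw [ZFSet.mem_prod, ZFSet.mem_sep, and_iff_right_of_imp]
    rintro ⟨x, hx, y, hy, rfl⟩
    have hx' := hΛ.transitive _ ha _ hx
    have hy' := hΛ.transitive _ hb _ hy
    rw [h2]
    refine ⟨hΛ.opair_mem_class hx' hy', fun z hz => ?_⟩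
    rw [h1]
    refine ⟨hΛ.transitive _ (hΛ.opair_mem_class hx' hy') _ hz, fun w hw => ?_⟩
    rw [ZFSet.mem_union]
    simp only [ZFSet.pair, ZFSet.mem_pair] at hz
    rcases hz with rfl | rfl
    · simp_all
    · simp only [ZFSet.mem_pair] at hw
      rcases hw with rfl | rfl <;> simp [*]
  · apply FODef.exMem hΛ (FOTerm.const ha)
    apply FODef.exMem hΛ (FOTerm.const hb)
    exact FODef.eq (.var _) (.pair hΛ (.var _) (.var _))

theorem exists_transitive (hΛ : IsZFCTheory Λ) (ha : a ∈ Λ) :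
    ∃ t ∈ Λ, a ∈ t ∧ t.IsTransitive := by
  -- Minimality of `t` makes `R` functional, as Replacement requires; the least transitive sets
  -- around the members of `a` are then collected by ∈-induction.
  let R : ZFSet.{u} → ZFSet.{u} → Prop := fun x t => (x ∈ t ∧ t.IsTransitive) ∧
    ∀ s ∈ Λ, x ∈ s → s.IsTransitive → t ⊆ s
  suffices h : ∃ t ∈ Λ, R a t by
    obtain ⟨t, ht, h, _⟩ := h
    exact ⟨t, ht, h⟩
  induction a using ZFSet.inductionOn with
  | _ a ih =>
    obtain ⟨c, hc, h⟩ := hΛ.replacement (R := R) ha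
      (by
        refine .and (.and (.mem (.var _) (.var _)) (.isTransitive hΛ (.var _))) ?_
        apply FODef.all
        exact .imp (.mem (.var _) (.var _))
          (.imp (.isTransitive hΛ (.var _)) (.subset hΛ (.var _) (.var _))))
      (fun x _ y hy z hz h1 h2 =>
        antisymm (h1.2 z hz h2.1.1 h2.1.2) (h2.2 y hy h1.1.1 h1.1.2))
    refine ⟨insert a (⋃₀ c : ZFSet.{u}), hΛ.insert_mem_class ha (hΛ.sUnion_mem_class hc),
      ⟨by simp, fun y hy z hz => ?_⟩, fun s hs has hst z hz => ?_⟩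
    · simp only [ZFSet.mem_insert_iff, ZFSet.mem_sUnion] at hy ⊢
      right
      rcases hy with rfl | ⟨t, ht, hyt⟩
      · obtain ⟨t, ht, hR⟩ := ih z hz (hΛ.transitive _ ha _ hz)
        exact ⟨t, (h t).2 ⟨ht, z, hz, hR⟩, hR.1.1⟩
      · obtain ⟨_, x, _, hR⟩ := (h t).1 ht
        exact ⟨t, ht, hR.1.2 y hyt hz⟩
    · simp only [ZFSet.mem_insert_iff, ZFSet.mem_sUnion] at hz
      rcases hz with rfl | ⟨t, ht, hzt⟩
      · exact has
      · obtain ⟨_, x, hx, hR⟩ := (h t).1 ht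
        exact hR.2 s hs (hst a has hx) hst hzt

end IsZFCTheory

end Closure

/-! ### The well-ordering theorem inside a ZFC set theory -/

section WellOrdering

variable {Λ : Set ZFSet.{u}} {A c h k : ZFSet.{u}}

/-- The sets `{X} × X`, for nonempty `Λ`-subsets `X` of `A`, are pairwise disjoint; a transversal of
them is a choice function. -/
theorem IsZFCTheory.exists_choice (hΛ : IsZFCTheory Λ) (hA : A ∈ Λ) :
    ∃ c ∈ Λ, ∀ X ∈ Λ, X ⊆ A → X ≠ ∅ → ∃! a, a ∈ X ∧ ZFSet.pair X a ∈ c := by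
  obtain ⟨P, hP, hP'⟩ := hΛ.exists_powerset hA
  -- A visibly first-order form of "`X` is nonempty and `Y = {X} × X`".
  let R : ZFSet.{u} → ZFSet.{u} → Prop := fun X Y =>
    (X ≠ ∅ ∧ ∀ a ∈ X, ZFSet.pair X a ∈ Y) ∧ ∀ z ∈ Y, ∃ a ∈ X, z = ZFSet.pair X a
  obtain ⟨F, hF, hF'⟩ := hΛ.replacement (R := R) hP
    (by
      refine .and (.and (.not (.eq (.var _) (.const hΛ.empty_mem_class))) ?_) ?_
      · apply FODef.allMem hΛ (.var _)
        exact .mem (.pair hΛ (.var _) (.var _)) (.var _)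
      · apply FODef.allMem hΛ (.var _)
        apply FODef.exMem hΛ (.var _)
        exact .eq (.var _) (.pair hΛ (.var _) (.var _)))
    (by
      rintro X _ Y _ Z _ ⟨⟨_, h1⟩, h2⟩ ⟨⟨_, h3⟩, h4⟩
      ext z
      constructor
      · intro hz
        obtain ⟨a, ha, rfl⟩ := h2 z hz
        exact h3 a ha
      · intro hz
        obtain ⟨a, ha, rfl⟩ := h4 z hz
        exact h1 a ha)
  obtain ⟨⟨c, hc⟩, h⟩ := hΛ.zfc.choice ⟨F, hF⟩
    (by
      rintro ⟨Y, hY⟩ hYF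
      obtain ⟨_, X, _, ⟨hX, h1⟩, _⟩ := (hF' Y).1 hYF
      obtain ⟨a, ha⟩ := (ZFSet.eq_empty_or_nonempty X).resolve_left hX
      exact ⟨⟨ZFSet.pair X a, hΛ.transitive _ hY _ (h1 a ha)⟩, h1 a ha⟩)
    (by
      rintro ⟨Y, hY⟩ ⟨Z, hZ⟩ hYF hZF ⟨⟨z, hz⟩, hzY, hzZ⟩
      obtain ⟨_, X, _, ⟨_, h1⟩, h2⟩ := (hF' Y).1 hYF
      obtain ⟨_, X', _, ⟨_, h3⟩, h4⟩ := (hF' Z).1 hZF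
      obtain ⟨a, ha, rfl⟩ := h2 z hzY
      obtain ⟨a', ha', h5⟩ := h4 _ hzZ
      obtain ⟨rfl, rfl⟩ := ZFSet.pair_inj.1 h5
      refine Subtype.ext (ZFSet.ext fun w => ⟨fun hw => ?_, fun hw => ?_⟩)
      · obtain ⟨b, hb, rfl⟩ := h2 w hw
        exact h3 b hb
      · obtain ⟨b, hb, rfl⟩ := h4 w hw
        exact h1 b hb)
  refine ⟨c, hc, fun X hX hXA hX0 => ?_⟩
  have hpair : ∀ a ∈ X, ZFSet.pair X a ∈ Λ := fun a ha =>
    hΛ.opair_mem_class hX (hΛ.transitive _ hX _ ha)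
  have hY : ZFSet.prod {X} X ∈ Λ := hΛ.prod_mem_class (hΛ.singleton_mem_class hX) hX
  have hYF : ZFSet.prod {X} X ∈ F :=
    (hF' _).2 ⟨hY, X, (hP' X).2 ⟨hX, hXA⟩, ⟨hX0, fun a ha => by simp [ha]⟩, fun z hz => by
      simpa using hz⟩
  obtain ⟨⟨z, hz⟩, ⟨hz1, hz2⟩, huniq⟩ := h ⟨_, hY⟩ hYF
  obtain ⟨X', hX', a, ha, rfl⟩ := ZFSet.mem_prod.1 hz1
  obtain rfl := ZFSet.mem_singleton.1 hX'
  refine ⟨a, ⟨ha, hz2⟩, fun b ⟨hb, hb'⟩ => ?_⟩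
  have := huniq ⟨ZFSet.pair X' b, hpair b hb⟩ ⟨by simp [hb], hb'⟩
  exact (ZFSet.pair_inj.1 (Subtype.ext_iff.1 this)).2

/-- A set `h` of pairs of an ordinal and an element of `A` that follows, up to some ordinal, the
enumeration of `A` by the choice function `c`: each ordinal is sent to the element that `c` chooses
among those not yet enumerated. -/
def IsEnumeration (Λ : Set ZFSet.{u}) (A c h : ZFSet.{u}) : Prop :=
  ∀ δ ∈ Λ, ∀ a ∈ Λ, ZFSet.pair δ a ∈ h → (δ.IsOrdinal ∧ ∀ ε ∈ δ, ∃ b ∈ A, ZFSet.pair ε b ∈ h) ∧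
    ∃ X ∈ Λ, (∀ x ∈ Λ, x ∈ X ↔ x ∈ A ∧ ¬ ∃ ε ∈ δ, ZFSet.pair ε x ∈ h) ∧
      a ∈ X ∧ ZFSet.pair X a ∈ c

theorem FODef.isEnumeration {n : ℕ} {x : (Fin n → Λ) → ZFSet.{u}} (hΛ : IsZFCTheory Λ)
    (hA : A ∈ Λ) (hc : c ∈ Λ) (hx : FOTerm x) :
    FODef (fun v => IsEnumeration Λ A c (x v)) := by
  refine FODef.subst (P := fun v y => IsEnumeration Λ A c y) ?_ hx
  apply FODef.all
  apply FODef.all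
  refine .imp (.mem (.pair hΛ (.var _) (.var _)) (.var _)) (.and (.and (.isOrdinal hΛ (.var _)) ?_) ?_)
  · apply FODef.allMem hΛ (.var _)
    apply FODef.exMem hΛ (.const hA)
    exact .mem (.pair hΛ (.var _) (.var _)) (.var _)
  · apply FODef.ex
    refine .and ?_ (.and (.mem (.var _) (.var _)) (.mem (.pair hΛ (.var _) (.var _)) (.const hc)))
    apply FODef.all
    refine .iff (.mem (.var _) (.var _)) (.and (.mem (.var _) (.const hA)) (.not ?_))
    apply FODef.exMem hΛ (.var _)
    exact .mem (.pair hΛ (.var _) (.var _)) (.var _)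

namespace IsEnumeration

/-- By ∈-induction, two enumerations agree below `δ`, so the same set of elements remains at stage
`δ` and `c` makes the same choice. -/
theorem eq (hΛ : IsZFCTheory Λ)
    (hc : ∀ X ∈ Λ, X ⊆ A → X ≠ ∅ → ∃! a, a ∈ X ∧ ZFSet.pair X a ∈ c)
    (hh : IsEnumeration Λ A c h) (hk : IsEnumeration Λ A c k) (hhΛ : h ∈ Λ) (hkΛ : k ∈ Λ)
    {δ a b : ZFSet.{u}} (ha : ZFSet.pair δ a ∈ h) (hb : ZFSet.pair δ b ∈ k) : a = b := by
  induction δ using ZFSet.inductionOn generalizing a b with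
  | _ δ ih =>
    obtain ⟨hδ, haΛ⟩ := hΛ.mem_class_of_opair (hΛ.transitive _ hhΛ _ ha)
    obtain ⟨_, hbΛ⟩ := hΛ.mem_class_of_opair (hΛ.transitive _ hkΛ _ hb)
    obtain ⟨⟨_, h1⟩, X, hX, hXh, haX, haX'⟩ := hh δ hδ a haΛ ha
    obtain ⟨⟨_, h2⟩, Y, hY, hYk, hbY, hbY'⟩ := hk δ hδ b hbΛ hb
    have hXY : X = Y := by
      have key : ∀ ε ∈ δ, ∀ x, ZFSet.pair ε x ∈ h ↔ ZFSet.pair ε x ∈ k := by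
        intro ε hε x
        obtain ⟨y, _, hy⟩ := h1 ε hε
        obtain ⟨z, _, hz⟩ := h2 ε hε
        exact ⟨fun hx => by rwa [ih ε hε hx hz], fun hx => by rwa [← ih ε hε hy hx]⟩
      have key' : ∀ x, (∃ ε ∈ δ, ZFSet.pair ε x ∈ h) ↔ ∃ ε ∈ δ, ZFSet.pair ε x ∈ k :=
        fun x => exists_congr fun ε => and_congr_right fun hε => key ε hε x
      ext x
      constructor
      · intro hx
        have hx' := hΛ.transitive _ hX _ hx
        rwa [hYk x hx', ← key', ← hXh x hx']
      · intro hx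
        have hx' := hΛ.transitive _ hY _ hx
        rwa [hXh x hx', key', ← hYk x hx']
    subst hXY
    refine (hc X hX (fun x hx => ((hXh x (hΛ.transitive _ hX _ hx)).1 hx).1) ?_).unique
      ⟨haX, haX'⟩ ⟨hbY, hbY'⟩
    rintro rfl
    exact ZFSet.notMem_empty _ haX

/-- An element enumerated at stage `δ` is no longer available at a later stage `ε`, and stages are
ordinals, hence comparable. -/
theorem injective (hΛ : IsZFCTheory Λ)
    (hc : ∀ X ∈ Λ, X ⊆ A → X ≠ ∅ → ∃! a, a ∈ X ∧ ZFSet.pair X a ∈ c)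
    (hh : IsEnumeration Λ A c h) (hk : IsEnumeration Λ A c k) (hhΛ : h ∈ Λ) (hkΛ : k ∈ Λ)
    {δ ε a : ZFSet.{u}} (ha : ZFSet.pair δ a ∈ h) (hb : ZFSet.pair ε a ∈ k) : δ = ε := by
  have key : ∀ {h k δ ε}, IsEnumeration Λ A c h → IsEnumeration Λ A c k → h ∈ Λ → k ∈ Λ →
      ZFSet.pair δ a ∈ h → ZFSet.pair ε a ∈ k → δ ∉ ε := by
    intro h k δ ε hh hk hhΛ hkΛ ha hb hδε
    obtain ⟨hε, haΛ⟩ := hΛ.mem_class_of_opair (hΛ.transitive _ hkΛ _ hb)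
    obtain ⟨⟨_, h1⟩, X, hX, hXk, haX, _⟩ := hk ε hε a haΛ hb
    obtain ⟨b, _, hb'⟩ := h1 δ hδε
    obtain rfl := hh.eq hΛ hc hk hhΛ hkΛ ha hb'
    exact ((hXk a haΛ).1 haX).2 ⟨δ, hδε, hb'⟩
  obtain ⟨hδ, haΛ⟩ := hΛ.mem_class_of_opair (hΛ.transitive _ hhΛ _ ha)
  obtain ⟨hε, _⟩ := hΛ.mem_class_of_opair (hΛ.transitive _ hkΛ _ hb)
  rcases (hh δ hδ a haΛ ha).1.1.mem_trichotomous (hk ε hε a haΛ hb).1.1 with h1 | h1 | h1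
  · exact (key hh hk hhΛ hkΛ ha hb h1).elim
  · exact h1
  · exact (key hk hh hkΛ hhΛ hb ha h1).elim

end IsEnumeration

/-- Every set of a ZFC set theory is enumerated, inside the theory, by an ordinal. -/
theorem IsZFCTheory.exists_ordinal_enumeration (hΛ : IsZFCTheory Λ) (hA : A ∈ Λ) :
    ∃ T ∈ Λ, T.IsOrdinal ∧ ∃ G ∈ Λ, (∀ a ∈ A, ∃ δ ∈ T, ZFSet.pair δ a ∈ G) ∧
      ∀ δ a b, ZFSet.pair δ a ∈ G → ZFSet.pair δ b ∈ G → a = b := by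
  obtain ⟨c, hcΛ, hc⟩ := hΛ.exists_choice hA
  -- Replacement is applied from elements to stages. The stages form a `Λ`-set, and being downward
  -- closed they form an ordinal.
  obtain ⟨T, hT, hT'⟩ := hΛ.replacement
    (R := fun a δ => ∃ h ∈ Λ, IsEnumeration Λ A c h ∧ ZFSet.pair δ a ∈ h) hA
    (by
      apply FODef.ex
      exact .and (.isEnumeration hΛ hA hcΛ (.var _)) (.mem (.pair hΛ (.var _) (.var _)) (.var _)))
    (by
      rintro a _ δ _ ε _ ⟨h, hhΛ, hh, ha⟩ ⟨k, hkΛ, hk, hb⟩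
      exact hh.injective hΛ hc hk hhΛ hkΛ ha hb)
  have hord : T.IsOrdinal := by
    refine isOrdinal_iff_forall_mem_isOrdinal.2 ⟨fun δ hδ ε hε => ?_, fun δ hδ => ?_⟩
    · obtain ⟨hδΛ, a, ha, h, hhΛ, hh, hah⟩ := (hT' δ).1 hδ
      obtain ⟨b, hb, hbh⟩ := (hh δ hδΛ a (hΛ.transitive _ hA _ ha) hah).1.2 ε hε
      exact (hT' ε).2 ⟨hΛ.transitive _ hδΛ _ hε, b, hb, h, hhΛ, hh, hbh⟩
    · obtain ⟨hδΛ, a, ha, h, hhΛ, hh, hah⟩ := (hT' δ).1 hδ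
      exact (hh δ hδΛ a (hΛ.transitive _ hA _ ha) hah).1.1
  let G := ZFSet.sep (fun p => ∃ h ∈ Λ, IsEnumeration Λ A c h ∧ p ∈ h) (ZFSet.prod T A)
  have hGΛ : G ∈ Λ := hΛ.sep_mem_class (hΛ.prod_mem_class hT hA) <| by
    apply FODef.ex
    exact .and (.isEnumeration hΛ hA hcΛ (.var _)) (.mem (.var _) (.var _))
  have hGh : ∀ {δ a}, ZFSet.pair δ a ∈ G ↔
      a ∈ A ∧ ∃ h ∈ Λ, IsEnumeration Λ A c h ∧ ZFSet.pair δ a ∈ h := by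
    intro δ a
    simp only [G, ZFSet.mem_sep, ZFSet.pair_mem_prod]
    refine ⟨fun h => ⟨h.1.2, h.2⟩, fun ⟨ha, h, hhΛ, hh, hah⟩ =>
      ⟨⟨(hT' δ).2 ⟨?_, a, ha, h, hhΛ, hh, hah⟩, ha⟩, h, hhΛ, hh, hah⟩⟩
    exact (hΛ.mem_class_of_opair (hΛ.transitive _ hhΛ _ hah)).1
  have hGT : ∀ {δ a}, ZFSet.pair δ a ∈ G → δ ∈ T := fun h =>
    (ZFSet.pair_mem_prod.1 (ZFSet.mem_sep.1 h).1).1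
  have hG : IsEnumeration Λ A c G := by
    intro δ hδ a ha hG
    obtain ⟨haA, h, hhΛ, hh, hah⟩ := hGh.1 hG
    obtain ⟨⟨h1, h2⟩, X, hX, hXh, haX, haX'⟩ := hh δ hδ a ha hah
    refine ⟨⟨h1, fun ε hε => ?_⟩, X, hX, fun x hx => ?_, haX, haX'⟩
    · obtain ⟨b, hb, hbh⟩ := h2 ε hε
      exact ⟨b, hb, hGh.2 ⟨hb, h, hhΛ, hh, hbh⟩⟩
    · rw [hXh x hx]
      refine and_congr_right fun hxA => not_congr <| exists_congr fun ε =>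
        and_congr_right fun hε => ⟨fun hxh => hGh.2 ⟨hxA, h, hhΛ, hh, hxh⟩, fun hxG => ?_⟩
      obtain ⟨_, k, hkΛ, hk, hxk⟩ := hGh.1 hxG
      obtain ⟨b, hb, hbh⟩ := h2 ε hε
      rwa [hk.eq hΛ hc hh hkΛ hhΛ hxk hbh]
  refine ⟨T, hT, hord, G, hGΛ, ?_, fun δ a b ha hb => hG.eq hΛ hc hG hGΛ hGΛ ha hb⟩
  -- If an element were missed, `G` could be extended by a choice at stage `T`; then `T` would
  -- itself be a stage, giving `T ∈ T`.
  by_contra! hne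
  obtain ⟨a₀, ha₀, hne⟩ := hne
  let X := ZFSet.sep (fun x => ¬ ∃ δ ∈ T, ZFSet.pair δ x ∈ G) A
  have hX : X ∈ Λ := hΛ.sep_mem_class hA <| by
    refine .not ?_
    apply FODef.exMem hΛ (.const hT)
    exact .mem (.pair hΛ (.var _) (.var _)) (.const hGΛ)
  have ha₀X : a₀ ∈ X := ZFSet.mem_sep.2 ⟨ha₀, by simpa using hne⟩
  obtain ⟨a, ⟨haX, haX'⟩, _⟩ := hc X hX (fun x hx => (ZFSet.mem_sep.1 hx).1)
    (by rintro h0; rw [h0] at ha₀X; exact ZFSet.notMem_empty _ ha₀X)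
  have haA : a ∈ A := (ZFSet.mem_sep.1 haX).1
  let H := insert (ZFSet.pair T a) G
  have hHΛ : H ∈ Λ :=
    hΛ.insert_mem_class (hΛ.opair_mem_class hT (hΛ.transitive _ hA _ haA)) hGΛ
  have hHG : ∀ {ε}, ε ∈ T → ∀ x, ZFSet.pair ε x ∈ H ↔ ZFSet.pair ε x ∈ G := by
    intro ε hε x
    simp only [H, ZFSet.mem_insert_iff, ZFSet.pair_inj, or_iff_right_iff_imp]
    rintro ⟨rfl, _⟩
    exact (ZFSet.mem_irrefl _ hε).elim
  have hGH : ∀ {p}, p ∈ G → p ∈ H := fun hp => ZFSet.mem_insert_of_mem _ hp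
  have hH : IsEnumeration Λ A c H := by
    intro δ hδ b hb hbH
    rcases ZFSet.mem_insert_iff.1 hbH with hp | hbG
    · obtain ⟨rfl, rfl⟩ := ZFSet.pair_inj.1 hp
      refine ⟨⟨hord, fun ε hε => ?_⟩, X, hX, fun x hx => ?_, haX, haX'⟩
      · obtain ⟨_, b, hb, h⟩ := (hT' ε).1 hε
        exact ⟨b, hb, hGH (hGh.2 ⟨hb, h⟩)⟩
      · rw [ZFSet.mem_sep]
        exact and_congr_right fun hxA => not_congr <| exists_congr fun ε =>
          and_congr_right fun hε => (hHG hε x).symm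
    · obtain ⟨⟨h1, h2⟩, Y, hY, hYG, hbY, hbY'⟩ := hG δ hδ b hb hbG
      refine ⟨⟨h1, fun ε hε => ?_⟩, Y, hY, fun x hx => ?_, hbY, hbY'⟩
      · obtain ⟨b, hb, h⟩ := h2 ε hε
        exact ⟨b, hb, hGH h⟩
      · rw [hYG x hx]
        exact and_congr_right fun hxA => not_congr <| exists_congr fun ε =>
          and_congr_right fun hε => (hHG (hord.mem_trans hε (hGT hbG)) x).symm
  exact ZFSet.mem_irrefl T ((hT' T).2 ⟨hT, a, haA, H, hHΛ, hH, ZFSet.mem_insert _ _⟩)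

end WellOrdering

/-! ### The Coherent Limit axiom makes a theory closed under arbitrary subsets -/

section Subsets

variable {Λ : Set ZFSet.{u}} {A B D T : ZFSet.{u}}

/-- The characteristic function on `D` of the members of `B`, as a set of pairs. -/
def characteristic (B D : ZFSet.{u}) : ZFSet.{u} :=
  ZFSet.sep (fun p => ∃ x ∈ D, ∃ v ∈ two, p = ZFSet.pair x v ∧ (v = {∅} ↔ x ∈ B)) (ZFSet.prod D two)

theorem pair_mem_characteristic {x v : ZFSet.{u}} :
    ZFSet.pair x v ∈ characteristic B D ↔ x ∈ D ∧ v ∈ two ∧ (v = {∅} ↔ x ∈ B) := by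
  simp only [characteristic, ZFSet.mem_sep, ZFSet.pair_mem_prod]
  constructor
  · rintro ⟨_, y, hy, w, hw, h, h'⟩
    obtain ⟨rfl, rfl⟩ := ZFSet.pair_inj.1 h
    exact ⟨hy, hw, h'⟩
  · rintro ⟨hx, hv, h⟩
    exact ⟨⟨hx, hv⟩, x, hx, v, hv, rfl, h⟩

theorem exists_pair_of_mem_characteristic {p : ZFSet.{u}} (hp : p ∈ characteristic B D) :
    ∃ x v, p = ZFSet.pair x v := by
  obtain ⟨_, x, _, v, _, rfl, _⟩ := ZFSet.mem_sep.1 hp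
  exact ⟨x, v, rfl⟩

theorem isFunc_characteristic : ZFSet.IsFunc D two (characteristic B D) := by
  refine ⟨ZFSet.sep_subset, fun x hx => ?_⟩
  have h01 : (∅ : ZFSet.{u}) ≠ {∅} := fun h => by
    have h' : (∅ : ZFSet.{u}) ∈ ({∅} : ZFSet.{u}) := ZFSet.mem_singleton.2 rfl
    rw [← h] at h'
    exact ZFSet.notMem_empty _ h'
  by_cases hxB : x ∈ B
  · refine ⟨{∅}, pair_mem_characteristic.2 ⟨hx, by simp [two], by simpa using hxB⟩,
      fun v hv => ?_⟩
    exact (pair_mem_characteristic.1 hv).2.2.2 hxB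
  · refine ⟨∅, pair_mem_characteristic.2 ⟨hx, by simp [two],
      iff_of_false h01 hxB⟩, fun v hv => ?_⟩
    obtain ⟨_, h1, h2⟩ := pair_mem_characteristic.1 hv
    exact (ZFSet.mem_pair.1 h1).resolve_right fun h => hxB (h2.1 h)

theorem restrict_characteristic {D' : ZFSet.{u}} (h : D' ⊆ D) :
    restrict (characteristic B D) D' = characteristic B D' := by
  ext p
  simp only [restrict, ZFSet.mem_sep]
  constructor
  · rintro ⟨hp, x, hx, v, rfl⟩
    rw [pair_mem_characteristic] at hp ⊢
    exact ⟨hx, hp.2⟩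
  · intro hp
    obtain ⟨x, v, rfl⟩ := exists_pair_of_mem_characteristic hp
    rw [pair_mem_characteristic] at hp ⊢
    exact ⟨⟨h hp.1, hp.2⟩, x, hp.1, v, rfl⟩

theorem IsZFCTheory.two_mem_class (hΛ : IsZFCTheory Λ) : two ∈ Λ :=
  hΛ.pair_mem_class hΛ.empty_mem_class (hΛ.singleton_mem_class hΛ.empty_mem_class)

/-- Only the trace of `B` on `D` must be a `Λ`-set, which is what the induction on ordinals supplies
before `B` is known to be one. -/
theorem IsZFCTheory.characteristic_mem_class (hΛ : IsZFCTheory Λ) (hD : D ∈ Λ)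
    (hB : ZFSet.sep (· ∈ B) D ∈ Λ) : characteristic B D ∈ Λ := by
  have h1 : ({∅} : ZFSet.{u}) ∈ Λ := hΛ.singleton_mem_class hΛ.empty_mem_class
  have : characteristic B D = ZFSet.sep (fun p => ∃ x ∈ D, ∃ v ∈ two, p = ZFSet.pair x v ∧
      (v = {∅} ↔ x ∈ ZFSet.sep (· ∈ B) D)) (ZFSet.prod D two) := by
    ext p
    simp only [characteristic, ZFSet.mem_sep]
    refine and_congr_right fun _ => exists_congr fun x => and_congr_right fun hx => ?_
    simp [hx]
  rw [this]
  refine hΛ.sep_mem_class (hΛ.prod_mem_class hD hΛ.two_mem_class) ?_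
  apply FODef.exMem hΛ (.const hD)
  apply FODef.exMem hΛ (.const hΛ.two_mem_class)
  exact .and (.eq (.var _) (.pair hΛ (.var _) (.var _)))
    (.iff (.eq (.var _) (.const h1)) (.mem (.var _) (.const hB)))

/-- The inclusion order of the members of a set. -/
def inclusionOrder (A : ZFSet.{u}) : ZFSet.{u} :=
  ZFSet.sep (fun p => ∃ x ∈ A, ∃ y ∈ A, p = ZFSet.pair x y ∧ x ⊆ y) (ZFSet.prod A A)

theorem pair_mem_inclusionOrder {x y : ZFSet.{u}} :
    ZFSet.pair x y ∈ inclusionOrder A ↔ x ∈ A ∧ y ∈ A ∧ x ⊆ y := by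
  simp only [inclusionOrder, ZFSet.mem_sep, ZFSet.pair_mem_prod]
  constructor
  · rintro ⟨_, a, ha, b, hb, h, h'⟩
    obtain ⟨rfl, rfl⟩ := ZFSet.pair_inj.1 h
    exact ⟨ha, hb, h'⟩
  · rintro ⟨hx, hy, h⟩
    exact ⟨⟨hx, hy⟩, x, hx, y, hy, rfl, h⟩

theorem IsZFCTheory.inclusionOrder_mem_class (hΛ : IsZFCTheory Λ) (hA : A ∈ Λ) :
    inclusionOrder A ∈ Λ := by
  refine hΛ.sep_mem_class (hΛ.prod_mem_class hA hA) ?_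
  apply FODef.exMem hΛ (.const hA)
  apply FODef.exMem hΛ (.const hA)
  exact .and (.eq (.var _) (.pair hΛ (.var _) (.var _))) (.subset hΛ (.var _) (.var _))

theorem isWellOrderOn_inclusionOrder (hT : T.IsOrdinal) : IsWellOrderOn T (inclusionOrder T) where
  subset_prod := ZFSet.sep_subset
  total a ha b hb := by
    rcases (hT.mem ha).subset_total (hT.mem hb) with h | h
    · exact .inl (pair_mem_inclusionOrder.2 ⟨ha, hb, h⟩)
    · exact .inr (pair_mem_inclusionOrder.2 ⟨hb, ha, h⟩)
  antisymm a _ b _ hab hba :=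
    antisymm (pair_mem_inclusionOrder.1 hab).2.2 (pair_mem_inclusionOrder.1 hba).2.2
  trans a ha b _ c hc hab hbc :=
    pair_mem_inclusionOrder.2 ⟨ha, hc, _root_.trans (pair_mem_inclusionOrder.1 hab).2.2
      (pair_mem_inclusionOrder.1 hbc).2.2⟩
  exists_least B hB hB0 := by
    obtain ⟨m, hm, hmB⟩ := ZFSet.regularity B hB0
    refine ⟨m, hm, fun b hb => pair_mem_inclusionOrder.2 ⟨hB hm, hB hb, ?_⟩⟩
    rw [← (hT.mem (hB hb)).notMem_iff_subset (hT.mem (hB hm))]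
    intro hbm
    exact ZFSet.notMem_empty b (by rw [← hmB]; simp [hb, hbm])

theorem initialSegment_inclusionOrder (hT : T.IsOrdinal) {a : ZFSet.{u}} (ha : a ∈ T) :
    initialSegment T (inclusionOrder T) a = insert a a := by
  ext c
  simp only [initialSegment, ZFSet.mem_sep, pair_mem_inclusionOrder, ZFSet.mem_insert_iff]
  constructor
  · rintro ⟨hc, _, _, h⟩
    exact ((hT.mem hc).subset_iff_eq_or_mem (hT.mem ha)).1 h
  · intro h
    have hc : c ∈ T := by
      rcases h with rfl | h
      · exact ha
      · exact hT.mem_trans h ha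
    exact ⟨hc, hc, ha, ((hT.mem hc).subset_iff_eq_or_mem (hT.mem ha)).2 h⟩

theorem diagonal_characteristic :
    diagonal A (fun a => characteristic B (insert a a)) = characteristic B A := by
  ext p
  simp only [diagonal, ZFSet.mem_sep]
  constructor
  · rintro ⟨_, a, ha, v, rfl, h⟩
    rw [pair_mem_characteristic] at h ⊢
    exact ⟨ha, h.2⟩
  · intro hp
    refine ⟨(ZFSet.mem_sep.1 hp).1, ?_⟩
    obtain ⟨x, v, rfl⟩ := exists_pair_of_mem_characteristic hp
    rw [pair_mem_characteristic] at hp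
    exact ⟨x, hp.1, v, rfl, pair_mem_characteristic.2 ⟨by simp, hp.2⟩⟩

theorem CoherentLimit.subset_ordinal_mem_class (hCL : CoherentLimit Λ) (hΛ : IsZFCTheory Λ)
    (hT : T.IsOrdinal) (hTΛ : T ∈ Λ) (hB : B ⊆ T) : B ∈ Λ := by
  induction T using ZFSet.inductionOn generalizing B with
  | _ T ih =>
    have hins : ∀ a ∈ T, insert a a ∈ Λ := fun a ha =>
      hΛ.insert_mem_class (hΛ.transitive _ hTΛ _ ha) (hΛ.transitive _ hTΛ _ ha)
    have hseg : ∀ a ∈ T, characteristic B (insert a a) ∈ Λ := by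
      intro a ha
      have haΛ := hΛ.transitive _ hTΛ _ ha
      refine hΛ.characteristic_mem_class (hins a ha) ?_
      have h := ih a ha (hT.mem ha) haΛ (B := ZFSet.sep (· ∈ B) a) ZFSet.sep_subset
      -- The trace of `B` on `a ∪ {a}` is `B ∩ a`, with `a` added when `a ∈ B`.
      by_cases haB : a ∈ B
      · convert hΛ.insert_mem_class haΛ h using 1
        ext x
        simp only [ZFSet.mem_sep, ZFSet.mem_insert_iff]
        grind
      · convert h using 1
        ext x
        simp only [ZFSet.mem_sep, ZFSet.mem_insert_iff]
        grind
    obtain ⟨h, _⟩ := hCL T hTΛ _ (hΛ.inclusionOrder_mem_class hTΛ) (isWellOrderOn_inclusionOrder hT)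
      (fun a => characteristic B (insert a a))
      (fun a ha => ⟨hseg a ha, by
        rw [initialSegment_inclusionOrder hT ha]; exact isFunc_characteristic⟩)
      (fun a ha b hb hba => by
        rw [initialSegment_inclusionOrder hT hb]
        have hba := (pair_mem_inclusionOrder.1 hba).2.2
        refine restrict_characteristic fun x hx => ?_
        rw [ZFSet.mem_insert_iff] at hx ⊢
        rcases hx with rfl | hx
        · exact ((hT.mem hb).subset_iff_eq_or_mem (hT.mem ha)).1 hba
        · exact .inr (hba hx))
    rw [diagonal_characteristic] at h
    have h1 : ({∅} : ZFSet.{u}) ∈ Λ := hΛ.singleton_mem_class hΛ.empty_mem_class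
    convert hΛ.sep_mem_class (P := fun x => ZFSet.pair x {∅} ∈ characteristic B T) hTΛ
      (.mem (.pair hΛ (.var _) (.const h1)) (.const h))
    ext x
    rw [ZFSet.mem_sep, pair_mem_characteristic]
    simp only [two, ZFSet.mem_pair, or_true, true_and, true_iff]
    exact ⟨fun hx => ⟨hB hx, hB hx, hx⟩, fun h => h.2.2⟩

/-- The stages at which members of `B` are enumerated form a subset of an ordinal, hence a `Λ`-set;
`B` is its image under the enumeration. -/
theorem CoherentLimit.subset_mem_class (hCL : CoherentLimit Λ) (hΛ : IsZFCTheory Λ)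
    (hA : A ∈ Λ) (hB : B ⊆ A) : B ∈ Λ := by
  obtain ⟨T, hT, hord, G, hG, hsurj, hfun⟩ := hΛ.exists_ordinal_enumeration hA
  have hS := hCL.subset_ordinal_mem_class hΛ hord hT
    (B := ZFSet.sep (fun δ => ∃ b ∈ B, ZFSet.pair δ b ∈ G) T) ZFSet.sep_subset
  convert hΛ.sep_mem_class (P := fun x => ∃ δ ∈ ZFSet.sep (fun δ => ∃ b ∈ B, ZFSet.pair δ b ∈ G) T,
    ZFSet.pair δ x ∈ G) hA ?_
  · ext x
    simp only [ZFSet.mem_sep]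
    constructor
    · intro hx
      obtain ⟨δ, hδ, h⟩ := hsurj x (hB hx)
      exact ⟨hB hx, δ, ⟨hδ, x, hx, h⟩, h⟩
    · rintro ⟨_, δ, ⟨_, b, hb, h⟩, h'⟩
      rwa [hfun δ x b h' h]
  · apply FODef.exMem hΛ (.const hS)
    exact .mem (.pair hΛ (.var _) (.var _)) (.const hG)

/-- Mostowski collapse: a theory closed under subsets contains every transitive set that
injects into one of its sets. -/
theorem CoherentLimit.transitive_mem_class (hCL : CoherentLimit Λ) (hΛ : IsZFCTheory Λ)
    (hA : A ∈ Λ) {t : ZFSet.{u}} (ht : t.IsTransitive) {e : ZFSet.{u} → ZFSet.{u}}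
    (heA : ∀ x ∈ t, e x ∈ A) (he : ∀ x ∈ t, ∀ y ∈ t, e x = e y → x = y) : t ∈ Λ := by
  let E := ZFSet.sep (fun p => ∃ x ∈ t, ∃ y ∈ t, x ∈ y ∧ p = ZFSet.pair (e x) (e y))
    (ZFSet.prod A A)
  have hE : E ∈ Λ := hCL.subset_mem_class hΛ (hΛ.prod_mem_class hA hA) ZFSet.sep_subset
  have hmemE : ∀ {a y}, y ∈ t → (ZFSet.pair a (e y) ∈ E ↔ ∃ x ∈ y, a = e x) := by
    intro a y hy
    simp only [E, ZFSet.mem_sep, ZFSet.pair_mem_prod]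
    constructor
    · rintro ⟨_, x, hx, z, hz, hxz, h⟩
      obtain ⟨rfl, h'⟩ := ZFSet.pair_inj.1 h
      obtain rfl := he y hy z hz h'
      exact ⟨x, hxz, rfl⟩
    · rintro ⟨x, hx, rfl⟩
      have hx' := ht.mem_trans hx hy
      exact ⟨⟨heA x hx', heA y hy⟩, x, hx', y, hy, hx, rfl⟩
  -- The collapse is described without recursion: `a` collapses to `x` when some bisimulation in `Λ`
  -- between `E` and membership relates them. This is first-order, so Replacement applies to `R`.
  let IsBisim : ZFSet.{u} → Prop := fun h => ∀ b ∈ Λ, ∀ y ∈ Λ, ZFSet.pair b y ∈ h →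
    (∀ a ∈ A, ZFSet.pair a b ∈ E → ∃ x ∈ y, ZFSet.pair a x ∈ h) ∧
      ∀ x ∈ y, ∃ a ∈ A, ZFSet.pair a b ∈ E ∧ ZFSet.pair a x ∈ h
  let R : ZFSet.{u} → ZFSet.{u} → Prop := fun a x => ∃ h ∈ Λ, IsBisim h ∧ ZFSet.pair a x ∈ h
  have hRdef : FODef (fun v : Fin 2 → Λ => R (v 0) (v 1)) := by
    apply FODef.ex
    refine .and ?_ (.mem (.pair hΛ (.var _) (.var _)) (.var _))
    apply FODef.all
    apply FODef.all
    refine .imp (.mem (.pair hΛ (.var _) (.var _)) (.var _)) (.and ?_ ?_)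
    · apply FODef.allMem hΛ (.const hA)
      refine .imp (.mem (.pair hΛ (.var _) (.var _)) (.const hE)) ?_
      apply FODef.exMem hΛ (.var _)
      exact .mem (.pair hΛ (.var _) (.var _)) (.var _)
    · apply FODef.allMem hΛ (.var _)
      apply FODef.exMem hΛ (.const hA)
      exact .and (.mem (.pair hΛ (.var _) (.var _)) (.const hE))
        (.mem (.pair hΛ (.var _) (.var _)) (.var _))
  have hRuniq : ∀ x ∈ t, ∀ y ∈ Λ, R (e x) y → y = x := by
    rintro x hx y hy ⟨h, hhΛ, hh, hxy⟩
    induction x using ZFSet.inductionOn generalizing y with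
    | _ x ih =>
      have hexΛ := hΛ.transitive _ hA _ (heA x hx)
      obtain ⟨h1, h2⟩ := hh (e x) hexΛ y hy hxy
      ext z
      constructor
      · intro hz
        obtain ⟨a, ha, haE, haz⟩ := h2 z hz
        obtain ⟨w, hw, rfl⟩ := (hmemE hx).1 haE
        rwa [ih w hw (ht.mem_trans hw hx) z (hΛ.transitive _ hy _ hz) haz]
      · intro hz
        have hz' := ht.mem_trans hz hx
        obtain ⟨w, hw, hwh⟩ := h1 (e z) (heA z hz') ((hmemE hx).2 ⟨z, hz, rfl⟩)
        rwa [← ih z hz hz' w (hΛ.transitive _ hy _ hw) hwh]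
  have hRself : ∀ x ∈ t, x ∈ Λ → R (e x) x := by
    intro x hx hxΛ
    obtain ⟨s, hs, hxs, hst⟩ := hΛ.exists_transitive hxΛ
    -- The graph of the decoding `e y ↦ y`, cut down to a transitive `Λ`-set `s` containing `x`, is
    -- a bisimulation; it lies in `Λ` as a subset of `A × s`.
    let h := ZFSet.sep (fun p => ∃ y ∈ t, p = ZFSet.pair (e y) y) (ZFSet.prod A s)
    have hmemh : ∀ {a y}, ZFSet.pair a y ∈ h ↔ y ∈ s ∧ y ∈ t ∧ a = e y := by
      intro a y
      simp only [h, ZFSet.mem_sep, ZFSet.pair_mem_prod]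
      constructor
      · rintro ⟨⟨_, hys⟩, z, hz, h⟩
        obtain ⟨rfl, rfl⟩ := ZFSet.pair_inj.1 h
        exact ⟨hys, hz, rfl⟩
      · rintro ⟨hys, hyt, rfl⟩
        exact ⟨⟨heA y hyt, hys⟩, y, hyt, rfl⟩
    refine ⟨h, hCL.subset_mem_class hΛ (hΛ.prod_mem_class hA hs) ZFSet.sep_subset, ?_,
      hmemh.2 ⟨hxs, hx, rfl⟩⟩
    intro b _ y _ hby
    obtain ⟨hys, hyt, rfl⟩ := hmemh.1 hby
    refine ⟨fun a ha haE => ?_, fun z hz => ?_⟩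
    · obtain ⟨z, hz, rfl⟩ := (hmemE hyt).1 haE
      exact ⟨z, hz, hmemh.2 ⟨hst.mem_trans hz hys, ht.mem_trans hz hyt, rfl⟩⟩
    · have hzt := ht.mem_trans hz hyt
      exact ⟨e z, heA z hzt, (hmemE hyt).2 ⟨z, hz, rfl⟩,
        hmemh.2 ⟨hst.mem_trans hz hys, hzt, rfl⟩⟩
  -- The codes of the members of `y` form a subset of `A`, and `R` decodes them, so `y` is obtained
  -- by Replacement.
  have key : ∀ y, y ⊆ t → (∀ x ∈ y, x ∈ Λ) → y ∈ Λ := by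
    intro y hyt hyΛ
    have hS := hCL.subset_mem_class hΛ hA (B := ZFSet.sep (fun a => ∃ x ∈ y, a = e x) A)
      ZFSet.sep_subset
    obtain ⟨c, hc, hc'⟩ := hΛ.replacement (R := R) hS hRdef (by
      intro a ha z hz w hw hz' hw'
      obtain ⟨_, x, hx, rfl⟩ := ZFSet.mem_sep.1 ha
      rw [hRuniq x (hyt hx) z hz hz', hRuniq x (hyt hx) w hw hw'])
    convert hc
    ext x
    rw [hc']
    constructor
    · intro hx
      exact ⟨hyΛ x hx, e x, ZFSet.mem_sep.2 ⟨heA x (hyt hx), x, hx, rfl⟩,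
        hRself x (hyt hx) (hyΛ x hx)⟩
    · rintro ⟨hx, a, ha, hR⟩
      obtain ⟨_, z, hz, rfl⟩ := ZFSet.mem_sep.1 ha
      rwa [hRuniq z (hyt hz) x hx hR]
  refine key t (fun _ h => h) fun x hx => ?_
  induction x using ZFSet.inductionOn with
  | _ x ih => exact key x (ht x hx) fun z hz => ih z hz (ht.mem_trans hz hx)

end Subsets

/-! ### Truncations -/

section Truncation

open Cardinal

variable {Λ : Set ZFSet.{u}} {A : ZFSet.{u}} {k : Cardinal.{u}}

theorem exists_injOn_of_card_le {t : ZFSet.{u}} (h : t.card ≤ A.card) :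
    ∃ e : ZFSet.{u} → ZFSet.{u}, (∀ x ∈ t, e x ∈ A) ∧ ∀ x ∈ t, ∀ y ∈ t, e x = e y → x = y := by
  classical
  obtain ⟨f⟩ := h
  refine ⟨fun x => if hx : x ∈ t then ((equivShrink A).symm (f (equivShrink t ⟨x, hx⟩))).1 else ∅,
    fun x hx => ?_, fun x hx y hy hxy => ?_⟩
  · simp only [hx, dif_pos]
    exact Subtype.prop _
  · simp only [hx, hy, dif_pos] at hxy
    simpa using hxy

theorem CoherentLimit.mem_class_of_card_le (hCL : CoherentLimit Λ) (hΛ : IsZFCTheory Λ)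
    (hA : A ∈ Λ) {t : ZFSet.{u}} (ht : t.IsTransitive) (h : t.card ≤ A.card) : t ∈ Λ := by
  obtain ⟨e, he, hinj⟩ := exists_injOn_of_card_le h
  exact hCL.transitive_mem_class hΛ hA ht he hinj

theorem CoherentLimit.powerset_mem_class (hCL : CoherentLimit Λ) (hΛ : IsZFCTheory Λ)
    (hA : A ∈ Λ) : ZFSet.powerset A ∈ Λ := by
  obtain ⟨c, hc, h⟩ := hΛ.exists_powerset hA
  convert hc
  ext x
  rw [ZFSet.mem_powerset, h]
  exact ⟨fun hx => ⟨hCL.subset_mem_class hΛ hA hx, hx⟩, And.right⟩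

theorem CoherentLimit.eq_univ_or_eq_truncation (hCL : CoherentLimit Λ) (hΛ : IsZFCTheory Λ) :
    Λ = Set.univ ∨ ∃ k : Cardinal.{u}, k.IsStrongLimit ∧ Λ = truncation k := by
  by_cases hall : ∀ c : Cardinal.{u}, ∃ A ∈ Λ, c ≤ A.card
  · refine .inl (Set.eq_univ_of_forall fun x => ?_)
    -- This von Neumann level is a transitive set having `x` as a member.
    obtain ⟨A, hA, h⟩ := hall (V_ (Order.succ x.rank)).card
    exact hΛ.transitive _ (hCL.mem_class_of_card_le hΛ hA (isTransitive_vonNeumann _) h) _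
      (mem_vonNeumann_succ x)
  · right
    push Not at hall
    obtain ⟨k, hk, hmin⟩ := WellFounded.has_min Cardinal.lt_wf
      {c : Cardinal.{u} | ∀ A ∈ Λ, A.card < c} hall
    have hlt : ∀ c < k, ∃ A ∈ Λ, c ≤ A.card := fun c hc => by
      by_contra! h
      exact hmin c h hc
    refine ⟨k, ⟨(bot_le.trans_lt (hk ∅ hΛ.empty_mem_class)).ne', fun c hc => ?_⟩,
      Set.ext fun x => ⟨fun hx => ?_, ?_⟩⟩
    · obtain ⟨A, hA, h⟩ := hlt c hc
      refine lt_of_le_of_lt ?_ (hk _ (hCL.powerset_mem_class hΛ hA))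
      rw [ZFSet.card_powerset]
      exact Cardinal.power_le_power_left two_ne_zero h
    · obtain ⟨t, ht, hxt, htrans⟩ := hΛ.exists_transitive hx
      exact ⟨t, htrans, htrans x hxt, hk t ht⟩
    · rintro ⟨t, htrans, hxt, htk⟩
      obtain ⟨A, hA, h⟩ := hlt _ htk
      exact hCL.subset_mem_class hΛ (hCL.mem_class_of_card_le hΛ hA htrans h) hxt

theorem isFunc_diagonal {A r : ZFSet.{u}} {f : ZFSet.{u} → ZFSet.{u}} (hr : IsWellOrderOn A r)
    (hf : ∀ a ∈ A, ZFSet.IsFunc (initialSegment A r a) two (f a)) :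
    ZFSet.IsFunc A two (diagonal A f) := by
  have hmem : ∀ {a v}, ZFSet.pair a v ∈ diagonal A f ↔
      a ∈ A ∧ v ∈ two ∧ ZFSet.pair a v ∈ f a := by
    intro a v
    simp only [diagonal, ZFSet.mem_sep, ZFSet.pair_mem_prod]
    constructor
    · rintro ⟨⟨ha, hv⟩, b, _, w, h, h'⟩
      obtain ⟨rfl, rfl⟩ := ZFSet.pair_inj.1 h
      exact ⟨ha, hv, h'⟩
    · rintro ⟨ha, hv, h⟩
      exact ⟨⟨ha, hv⟩, a, ha, v, rfl, h⟩
  refine ⟨ZFSet.sep_subset, fun a ha => ?_⟩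
  have haa : a ∈ initialSegment A r a :=
    ZFSet.mem_sep.2 ⟨ha, (hr.total a ha a ha).elim id id⟩
  obtain ⟨v, hv, huniq⟩ := (hf a ha).2 a haa
  refine ⟨v, hmem.2 ⟨ha, (ZFSet.pair_mem_prod.1 ((hf a ha).1 hv)).2, hv⟩, fun w hw => ?_⟩
  exact huniq w (hmem.1 hw).2.2

theorem coherentLimit_univ : CoherentLimit (Set.univ : Set ZFSet.{u}) :=
  fun _ _ _ _ hr _ hf _ => ⟨Set.mem_univ _, isFunc_diagonal hr fun a ha => (hf a ha).2⟩

/-- A transitive set witnessing that `A × 2` is in the truncation also witnesses it for the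
diagonal, a subset of `A × 2`. -/
theorem coherentLimit_truncation (hΛ : IsZFCTheory (truncation k)) :
    CoherentLimit (truncation k) := by
  intro A hA r _ hr f hf _
  refine ⟨?_, isFunc_diagonal hr fun a ha => (hf a ha).2⟩
  obtain ⟨t, ht, hAt, htk⟩ := hΛ.prod_mem_class hA hΛ.two_mem_class
  exact ⟨t, ht, _root_.trans ZFSet.sep_subset hAt, htk⟩

theorem strongReplacement_univ : StrongReplacement (Set.univ : Set ZFSet.{u}) :=
  fun A _ f _ => ⟨ZFSet.range fun a : A => f a, Set.mem_univ _, fun a ha =>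
    ZFSet.mem_range.2 ⟨⟨a, ha⟩, rfl⟩⟩

theorem card_lt_of_mem_truncation {x : ZFSet.{u}} (hx : x ∈ truncation k) : x.card < k := by
  obtain ⟨t, _, hxt, htk⟩ := hx
  exact (ZFSet.card_mono hxt).trans_lt htk

theorem strongReplacement_truncation (hk : k.IsRegular) : StrongReplacement (truncation k) := by
  intro A hA f hf
  choose! t ht hft htk using hf
  have hA' := card_lt_of_mem_truncation hA
  let g : Shrink.{u} A → ZFSet.{u} := fun i => ((equivShrink A).symm i).1
  have hg : ∀ i, g i ∈ A := fun i => Subtype.prop _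
  -- Adding the value to a transitive set that includes it keeps the set transitive and makes the
  -- value a member, so the union of all `T i` is its own witness.
  let T : Shrink.{u} A → ZFSet.{u} := fun i => insert (f (g i)) (t (g i))
  have hT : ∀ i, (T i).IsTransitive := by
    intro i y hy z hz
    rw [ZFSet.mem_insert_iff] at hy ⊢
    right
    rcases hy with rfl | hy
    · exact hft _ (hg i) hz
    · exact (ht _ (hg i)).mem_trans hz hy
  refine ⟨ZFSet.iUnion T, ⟨_, IsTransitive.iUnion hT, fun _ h => h, ?_⟩, fun a ha => ?_⟩
  · have h := ZFSet.lift_card_iUnion_le_sum_card (f := T)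
    rw [Cardinal.lift_id] at h
    refine h.trans_lt (Cardinal.sum_lt_of_isRegular hk hA' fun i => ?_)
    refine (ZFSet.card_insert_le).trans_lt (Cardinal.add_lt_of_lt hk.aleph0_le (htk _ (hg i)) ?_)
    exact Cardinal.one_lt_aleph0.trans_le hk.aleph0_le
  · exact ZFSet.mem_iUnion.2 ⟨equivShrink A ⟨a, ha⟩, by simp [g]⟩

theorem toZFSet_mem_truncation {o : Ordinal.{u}} (h : o.card < k) : o.toZFSet ∈ truncation k :=
  ⟨_, (isOrdinal_toZFSet o).isTransitive, fun _ h => h, by rwa [Ordinal.card_toZFSet]⟩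

theorem isRegular_of_strongReplacement (hk : k.IsStrongLimit) (hΛ : IsZFCTheory (truncation k))
    (hSR : StrongReplacement (truncation k)) : k.IsRegular := by
  classical
  refine ⟨hk.aleph0_le, ?_⟩
  rw [← Ordinal.cof_toType, Order.le_cof_iff]
  intro ι hcof
  by_contra! hι
  let f : ι → Ordinal.{u} := fun i => (Ordinal.ToType.mk.symm i.1).1
  have hfk : ∀ i, f i < k.ord := fun i => (Ordinal.ToType.mk.symm i.1).2
  -- An initial ordinal serves as an index set for the short cofinal family `ι`, since it lies in
  -- the truncation and is in bijection with `ι`.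
  let A := (#ι).ord.toZFSet
  have hA : A ∈ truncation k := toZFSet_mem_truncation (by simpa using hι)
  have hAι : #ι = A.card := by simp [A]
  obtain ⟨e⟩ := Cardinal.eq.1 hAι
  obtain ⟨B, hB, hfB⟩ := hSR A hA
    (fun a => if ha : a ∈ A then (f (e.symm (equivShrink A ⟨a, ha⟩))).toZFSet else ∅) (by
      intro a ha
      simp only [ha, dif_pos]
      exact toZFSet_mem_truncation (Cardinal.lt_ord.1 (hfk _)))
  have hiB : ∀ i, (f i).toZFSet ∈ B := by
    intro i
    simpa using hfB ((equivShrink A).symm (e i)).1 (Subtype.prop _)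
  -- Cofinality gives only `o ≤ f i`: equality puts `o` in `B`, strict inequality in `⋃₀ B`. So this
  -- set of the truncation has at least `k` members, which is absurd.
  have hsub : k.ord.toZFSet ⊆ B ∪ ⋃₀ B := by
    intro x hx
    obtain ⟨o, ho, rfl⟩ := Ordinal.mem_toZFSet_iff.1 hx
    obtain ⟨j, hj, hoj⟩ := hcof (Ordinal.ToType.mk ⟨o, ho⟩)
    obtain ⟨i, hi⟩ : ∃ i, o ≤ f i :=
      ⟨⟨j, hj⟩, by simpa only [OrderIso.symm_apply_apply] using
        Subtype.coe_le_coe.2 (Ordinal.ToType.mk.symm.monotone hoj)⟩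
    rw [ZFSet.mem_union, ZFSet.mem_sUnion]
    rcases hi.eq_or_lt with rfl | hi
    · exact .inl (hiB i)
    · exact .inr ⟨_, hiB i, Ordinal.toZFSet_mem_toZFSet_iff.2 hi⟩
  have h1 := card_lt_of_mem_truncation (hΛ.union_mem_class hB (hΛ.sUnion_mem_class hB))
  have h2 := ZFSet.card_mono hsub
  rw [Ordinal.card_toZFSet, Cardinal.card_ord] at h2
  exact (h2.trans_lt h1).false

end Truncation

end RelaxedSet


theorem mainTheorem2 (Λ : Set ZFSet.{u}) (hΛ : RelaxedSet.IsZFCTheory Λ) :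
    ((Λ = Set.univ ∨ ∃ k : Cardinal.{u}, k.IsStrongLimit ∧ Λ = RelaxedSet.truncation k) ↔
      RelaxedSet.CoherentLimit Λ) ∧
    ((Λ = Set.univ ∨ ∃ k : Cardinal.{u},
        k.IsRegular ∧ k.IsStrongLimit ∧ Λ = RelaxedSet.truncation k) ↔
      RelaxedSet.CoherentLimit Λ ∧ RelaxedSet.StrongReplacement Λ) := by
  refine ⟨⟨?_, fun h => h.eq_univ_or_eq_truncation hΛ⟩, ⟨?_, fun ⟨hCL, hSR⟩ => ?_⟩⟩
  · rintro (rfl | ⟨k, _, rfl⟩)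
    · exact RelaxedSet.coherentLimit_univ
    · exact RelaxedSet.coherentLimit_truncation hΛ
  · rintro (rfl | ⟨k, hk, _, rfl⟩)
    · exact ⟨RelaxedSet.coherentLimit_univ, RelaxedSet.strongReplacement_univ⟩
    · exact ⟨RelaxedSet.coherentLimit_truncation hΛ, RelaxedSet.strongReplacement_truncation hk⟩
  · rcases hCL.eq_univ_or_eq_truncation hΛ with h | ⟨k, hk, rfl⟩
    · exact .inl h
    · exact .inr ⟨k, RelaxedSet.isRegular_of_strongReplacement hk hΛ hSR, hk, rfl⟩
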